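/- **Theorem (Finite-Blocklength List-Version).** Throughout, $\log$ is the base-2 and $\ln$ the natural logarithm, $a\wedge b=\min\{a,b\}$ and $a\vee b=\max\{a,b\}$. Let $\mathcal X,\mathcal Y,\mathcal M_1,\mathcal M_2$ be finite sets, $P_{X,Y}$ a PMF on $\mathcal X\times\mathcal Y$, and $\rho>0$; put $\tilde\rho=1/(1+\rho)$ and let $$H_{\alpha}(X|Y)=\frac{\alpha}{1-\alpha}\log\sum_{y\in\mathcal Y}\Bigl(\sum_{x\in\mathcal X}P_{X,Y}(x,y)^{\alpha}\Bigr)^{1/\alpha}$$ be the conditional Rényi entropy. The pair $(X,Y)$ is drawn according to $P_{X,Y}$, and upon observing $(X,Y)=(x,y)$ Alice draws the hints $(M_1,M_2)\in\mathcal M_1\times\mathcal M_2$ according to a conditional PMF $\Pr[M_1=m_1,M_2=m_2\mid X=x,Y=y]$. Bob observes $(Y,M_1,M_2)$; his ambiguity is $$\mathscr A_{\mathrm B}^{(\mathrm l)}=\mathbb E\bigl[|\mathcal L^Y_{M_1,M_2}|^\rho\bigr],\qquad \mathcal L^y_{m_1,m_2}=\{x:\Pr[X=x\mid Y=y,M_1=m_1,M_2=m_2]>0\}.$$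 Eve observes $Y$ and one of the hints. Her ambiguity is $$\mathscr A_{\mathrm E}=\min_{G_1,G_2}\mathbb E\bigl[G_1(X|Y,M_1)^\rho\wedge G_2(X|Y,M_2)^\rho\bigr],$$ and we also let $$\tilde{\mathscr A}_{\mathrm E}=\min_{k\in\{1,2\}}\min_{G_k}\mathbb E\bigl[G_k(X|Y,M_k)^\rho\bigr],$$ where $G_k$ ranges over the guessing functions for $X$ given $(Y,M_k)$, i.e. $G_k(\cdot|y,m_k)$ is a bijection $\mathcal X\to\{1,\dots,|\mathcal X|\}$ for every $(y,m_k)\in\mathcal Y\times\mathcal M_k$. *Achievability.* If $|\mathcal M_1|\,|\mathcal M_2|>\log|\mathcal X|+2$, then for all positive integers $c_{\mathrm s},c_1,c_2$ satisfying $$c_{\mathrm s}\le|\mathcal M_1|\wedge|\mathcal M_2|,\quad c_1\le\lfloor|\mathcal M_1|/c_{\mathrm s}\rfloor,\quad c_2\le\lfloor|\mathcal M_2|/c_{\mathrm s}\rfloor,\quad c_{\mathrm s}c_1c_2>\log|\mathcal X|+2,$$ there is a choice of Alice's conditional PMF for which both $$\mathscr A_{\mathrm B}^{(\mathrm l)}<1+2^{\rho(H_{\tilde\rho}(X|Y)-\log(c_{\mathrm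 s}c_1c_2-\log|\mathcal X|-2)+2)}$$ and $$\mathscr A_{\mathrm E}\ge(1+\ln|\mathcal X|)^{-\rho}\,2^{\rho(H_{\tilde\rho}(X|Y)-\log(c_1+c_2))}.$$ *Converse.* For every choice of Alice's conditional PMF, $$\mathscr A_{\mathrm B}^{(\mathrm l)}\ge 2^{\rho(H_{\tilde\rho}(X|Y)-\log(|\mathcal M_1|\,|\mathcal M_2|))}\vee 1,$$ $$\mathscr A_{\mathrm E}\le\Bigl[\bigl(|\mathcal M_1|\wedge|\mathcal M_2|\bigr)^\rho\,\mathscr A_{\mathrm B}^{(\mathrm l)}\Bigr]\wedge 2^{\rho H_{\tilde\rho}(X|Y)},$$ and the last inequality also holds with $\tilde{\mathscr A}_{\mathrm E}$ in place of $\mathscr A_{\mathrm E}$. -/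

import Mathlib

namespace DistStor

noncomputable section

/-- Conditional Rényi entropy (Arimoto), in bits, of order `α ∈ (0,1) ∪ (1,∞)`:
`H_α(X|Y) = α/(1-α) · log₂ ∑_y (∑_x P(x,y)^α)^{1/α}`. -/
def condRenyiEntropy {X Y : Type*} [Fintype X] [Fintype Y] (α : ℝ) (P : PMF (X × Y)) : ℝ :=
  α / (1 - α) * Real.logb 2 (∑ y, (∑ x, (P (x, y)).toReal ^ α) ^ (1 / α))

/-- A guessing function for `X` given an observation in `S`: for each observation a bijection from
`X` onto the `|X|` positions of the guessing order (position `i : Fin |X|` is guess number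
`i + 1`, see `guessNo`). -/
abbrev GuessFun (X S : Type*) [Fintype X] : Type _ := S → X ≃ Fin (Fintype.card X)

/-- `G(x|s) ∈ {1, …, |X|}`, the number of guesses needed when the observation is `s` and the
realization is `x`. -/
def guessNo {X S : Type*} [Fintype X] (G : GuessFun X S) (x : X) (s : S) : ℕ :=
  (G s x : ℕ) + 1

/-- Alice's encoder: a conditional PMF of the hint pair `(M₁, M₂)` given `(X, Y)`. -/
abbrev Encoder (X Y M₁ M₂ : Type*) : Type _ := X × Y → PMF (M₁ × M₂)

section

variable {X Y M₁ M₂ : Type*} [Fintype X] [Fintype Y] [Fintype M₁] [Fintype M₂]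

/-- Joint probability of `X = x, Y = y, M₁ = m₁, M₂ = m₂`. -/
def jointProb (P : PMF (X × Y)) (W : Encoder X Y M₁ M₂) (x : X) (y : Y) (m₁ : M₁) (m₂ : M₂) : ℝ :=
  (P (x, y)).toReal * (W (x, y) (m₁, m₂)).toReal

/-- Expectation of `f(X, Y, M₁, M₂)` under the joint law. -/
def expect (P : PMF (X × Y)) (W : Encoder X Y M₁ M₂) (f : X → Y → M₁ → M₂ → ℝ) : ℝ :=
  ∑ x, ∑ y, ∑ m₁, ∑ m₂, jointProb P W x y m₁ m₂ * f x y m₁ m₂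

/-- Posterior probability of `X = x` given `Y = y, M₁ = m₁, M₂ = m₂`
(zero if the conditioning event has probability zero). -/
def posterior (P : PMF (X × Y)) (W : Encoder X Y M₁ M₂) (x : X) (y : Y) (m₁ : M₁) (m₂ : M₂) : ℝ :=
  jointProb P W x y m₁ m₂ / ∑ x', jointProb P W x' y m₁ m₂

/-- Bob's list: all realizations of `X` of positive posterior probability. -/
def bobList (P : PMF (X × Y)) (W : Encoder X Y M₁ M₂) (y : Y) (m₁ : M₁) (m₂ : M₂) : Set X :=
  {x | 0 < posterior P W x y m₁ m₂}

/-- Bob's ambiguity in the list version: the `ρ`-th moment of the size of his list. -/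
def bobListAmbiguity (ρ : ℝ) (P : PMF (X × Y)) (W : Encoder X Y M₁ M₂) : ℝ :=
  expect P W fun _ y m₁ m₂ => ((bobList P W y m₁ m₂).ncard : ℝ) ^ ρ

/-- Eve's ambiguity: the accomplice sees `(X, Y)` and reveals the better hint. There are only
finitely many guessing functions and at least one, so the infimum is a minimum. -/
def eveAmbiguity (ρ : ℝ) (P : PMF (X × Y)) (W : Encoder X Y M₁ M₂) : ℝ :=
  ⨅ G : GuessFun X (Y × M₁) × GuessFun X (Y × M₂),
    expect P W fun x y m₁ m₂ =>
      min ((guessNo G.1 x (y, m₁) : ℝ) ^ ρ) ((guessNo G.2 x (y, m₂) : ℝ) ^ ρ)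

/-- Eve's alternative ambiguity: the revealed hint does not depend on the realization of `(X, Y)`.
The infima are minima. -/
def eveAltAmbiguity (ρ : ℝ) (P : PMF (X × Y)) (W : Encoder X Y M₁ M₂) : ℝ :=
  min
    (⨅ G : GuessFun X (Y × M₁), expect P W fun x y m₁ _ => (guessNo G x (y, m₁) : ℝ) ^ ρ)
    (⨅ G : GuessFun X (Y × M₂), expect P W fun x y _ m₂ => (guessNo G x (y, m₂) : ℝ) ^ ρ)

end

end

end DistStor

/-!
For fixed side information `y`, everything is governed by the quasi-norm of order `1 / (1 + ρ)` of
the weights `P(·, y)`, whose sum over `y` is `2 ^ (ρ H)`. Normalizing the powers of these weights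
gives the escort distribution, and the moment of its reciprocal is exactly the quasi-norm.

Guessing in decreasing order of a probability vector `q` needs at most `1 / q(x)` guesses to find
`x`. With the escort distribution as `q` this bounds Eve's ambiguity by `2 ^ (ρ H)`. Given the
first hint, let `q` be the mixture of the uniform distributions on Bob's lists over all values of
the second hint: the number of guesses is at most `|M₂|` times the size of Bob's list. Bob's
ambiguity is bounded from below by Hölder's inequality on each of his lists and by the
subadditivity of the quasi-norm up to the factor `(|M₁| |M₂|) ^ ρ`.

For the achievability, sorting the `x` into dyadic classes of target list size, proportional to
the reciprocal escort weight, and cutting each class into blocks of that size describes `x` by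
`(k, a, b)` with short lists. The hints are `(k + u, a)` and `(u, b)` for a one-time pad `u`, so
that Bob recovers the description, while a single hint reveals only `a` or only `b`. Since the
reciprocals of the guess numbers of one observation sum to at most `1 + ln |X|`, those of the
smaller of Eve's two guess numbers sum, on average over `u`, to at most
`(c₁ + c₂) (1 + ln |X|)`, and Hölder's inequality bounds the moment from below.
-/
namespace DistStor

open Finset

theorem rpow_sum_le_sum_rpow {ι : Type*} (s : Finset ι) {w : ι → ℝ} (hw : 0 ≤ w) {p : ℝ}
    (hp₀ : 0 < p) (hp₁ : p ≤ 1) : (∑ i ∈ s, w i) ^ p ≤ ∑ i ∈ s, w i ^ p :=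
  le_sum_of_subadditive_on_pred (fun x : ℝ => x ^ p) (0 ≤ ·) (Real.zero_rpow hp₀.ne').le
    (fun _ _ hx hy => Real.rpow_add_le_add_rpow hx hy hp₀.le hp₁) (fun _ _ => add_nonneg) w
    fun i _ => hw i

section TiltedNorm

variable {ι κ : Type*} [Fintype ι] [Fintype κ] {ρ : ℝ} {w : ι → ℝ}

/-- The `ℓ^α` quasi-norm of nonnegative weights, where the order `α = 1 / (1 + ρ)` is recorded
through the moment exponent `ρ`. -/
noncomputable def tiltedNorm (ρ : ℝ) (w : ι → ℝ) : ℝ :=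
  (∑ i, w i ^ (1 + ρ)⁻¹) ^ (1 + ρ)

/-- The escort distribution of nonnegative weights: their powers of order `1 / (1 + ρ)`,
normalized. Its reciprocals are the target sizes for guess numbers and for lists. It vanishes
identically when the weights do. -/
noncomputable def escort (ρ : ℝ) (w : ι → ℝ) (i : ι) : ℝ :=
  w i ^ (1 + ρ)⁻¹ / ∑ j, w j ^ (1 + ρ)⁻¹

theorem tiltedNorm_nonneg (hw : 0 ≤ w) : 0 ≤ tiltedNorm ρ w :=
  Real.rpow_nonneg (sum_nonneg fun i _ => Real.rpow_nonneg (hw i) _) _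

theorem tiltedNorm_pos (hw : 0 ≤ w) {i : ι} (hi : 0 < w i) : 0 < tiltedNorm ρ w :=
  Real.rpow_pos_of_pos (sum_pos' (fun j _ => Real.rpow_nonneg (hw j) _)
    ⟨i, mem_univ i, Real.rpow_pos_of_pos hi _⟩) _

theorem tiltedNorm_le_sum_mul_rpow_mul_sum_inv_rpow (hρ : 0 ≤ ρ) (hw : 0 ≤ w) {a : ι → ℝ}
    (ha : ∀ i, 0 < a i) :
    tiltedNorm ρ w ≤ (∑ i, w i * a i ^ ρ) * (∑ i, (a i)⁻¹) ^ ρ := by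
  have hρ' : 1 + ρ ≠ 0 := by positivity
  have hq : ∀ i, 0 ≤ w i ^ (1 + ρ)⁻¹ := fun i => Real.rpow_nonneg (hw i) _
  have hinv : ∀ i, 0 ≤ (a i)⁻¹ := fun i => (inv_pos.2 (ha i)).le
  have hcancel : ∀ i, (a i)⁻¹ * (w i ^ (1 + ρ)⁻¹ * a i) = w i ^ (1 + ρ)⁻¹ := fun i => by
    field_simp [(ha i).ne']
  have hmoment : ∀ i, (a i)⁻¹ * (w i ^ (1 + ρ)⁻¹ * a i) ^ (1 + ρ) = w i * a i ^ ρ := fun i => by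
    rw [Real.mul_rpow (hq i) (ha i).le, Real.rpow_inv_rpow (hw i) hρ',
      Real.rpow_one_add' (ha i).le hρ']
    field_simp [(ha i).ne']
  have hmoment_nonneg : 0 ≤ ∑ i, w i * a i ^ ρ :=
    sum_nonneg fun i _ => mul_nonneg (hw i) (Real.rpow_nonneg (ha i).le _)
  have hHolder := Real.inner_le_weight_mul_Lp_of_nonneg univ (p := 1 + ρ) (by linarith)
    (fun i => (a i)⁻¹) (fun i => w i ^ (1 + ρ)⁻¹ * a i) hinv
    fun i => mul_nonneg (hq i) (ha i).le
  simp only [hcancel, hmoment] at hHolder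
  calc tiltedNorm ρ w
      ≤ ((∑ i, (a i)⁻¹) ^ (1 - (1 + ρ)⁻¹) * (∑ i, w i * a i ^ ρ) ^ (1 + ρ)⁻¹) ^ (1 + ρ) :=
        Real.rpow_le_rpow (sum_nonneg fun i _ => hq i) hHolder (by positivity)
    _ = (∑ i, (a i)⁻¹) ^ ρ * ∑ i, w i * a i ^ ρ := by
        have hsum : 0 ≤ ∑ i, (a i)⁻¹ := sum_nonneg fun i _ => hinv i
        rw [Real.mul_rpow (Real.rpow_nonneg hsum _) (Real.rpow_nonneg hmoment_nonneg _),
          Real.rpow_inv_rpow hmoment_nonneg hρ', ← Real.rpow_mul hsum, sub_mul,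
          inv_mul_cancel₀ hρ', one_mul, add_sub_cancel_left]
    _ = (∑ i, w i * a i ^ ρ) * (∑ i, (a i)⁻¹) ^ ρ := mul_comm _ _

theorem tiltedNorm_le_ncard_rpow_mul_sum (hρ : 0 ≤ ρ) (hw : 0 ≤ w) :
    tiltedNorm ρ w ≤ ({i | 0 < w i}.ncard : ℝ) ^ ρ * ∑ i, w i := by
  classical
  have hρ' : 1 + ρ ≠ 0 := by positivity
  have hzero : ∀ i ∈ univ, i ∉ ({i | 0 < w i} : Finset ι) → w i = 0 := fun i _ hi =>
    le_antisymm (by simpa using hi) (hw i)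
  have hpower := Real.rpow_sum_le_const_mul_sum_rpow_of_nonneg (p := 1 + ρ)
    (s := ({i | 0 < w i} : Finset ι)) (f := fun i => w i ^ (1 + ρ)⁻¹) (by linarith)
    fun i _ => Real.rpow_nonneg (hw i) _
  simp only [fun i => Real.rpow_inv_rpow (hw i) hρ', add_sub_cancel_left] at hpower
  rwa [sum_subset (filter_subset _ _) hzero, sum_subset (filter_subset _ _) fun i h hi => by
      rw [hzero i h hi, Real.zero_rpow (inv_ne_zero hρ')],
    ← Set.ncard_coe_finset, coe_filter_univ] at hpower

theorem tiltedNorm_sum_le (hρ : 0 ≤ ρ) {J : κ → ι → ℝ} (hJ : ∀ k, 0 ≤ J k) :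
    tiltedNorm ρ (fun i => ∑ k, J k i) ≤ (Fintype.card κ : ℝ) ^ ρ * ∑ k, tiltedNorm ρ (J k) := by
  have hq : ∀ k i, 0 ≤ J k i ^ (1 + ρ)⁻¹ := fun k i => Real.rpow_nonneg (hJ k i) _
  have hsubadd : ∀ i, (∑ k, J k i) ^ (1 + ρ)⁻¹ ≤ ∑ k, J k i ^ (1 + ρ)⁻¹ := fun i =>
    rpow_sum_le_sum_rpow univ (fun k => hJ k i) (by positivity)
      (inv_le_one_of_one_le₀ (by linarith))
  calc tiltedNorm ρ (fun i => ∑ k, J k i)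
      ≤ (∑ i, ∑ k, J k i ^ (1 + ρ)⁻¹) ^ (1 + ρ) :=
        Real.rpow_le_rpow
          (sum_nonneg fun i _ => Real.rpow_nonneg (sum_nonneg fun k _ => hJ k i) _)
          (sum_le_sum fun i _ => hsubadd i) (by positivity)
    _ = (∑ k, ∑ i, J k i ^ (1 + ρ)⁻¹) ^ (1 + ρ) := by rw [sum_comm]
    _ ≤ (#(univ : Finset κ) : ℝ) ^ (1 + ρ - 1) * ∑ k, tiltedNorm ρ (J k) :=
        Real.rpow_sum_le_const_mul_sum_rpow_of_nonneg (s := univ) (p := 1 + ρ) (by linarith)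
          fun k _ => sum_nonneg fun i _ => hq k i
    _ = (Fintype.card κ : ℝ) ^ ρ * ∑ k, tiltedNorm ρ (J k) := by
        rw [card_univ, add_sub_cancel_left]

theorem tiltedNorm_comp_fst (hw : 0 ≤ w) :
    tiltedNorm ρ (fun p : ι × κ => w p.1) = (Fintype.card κ : ℝ) ^ (1 + ρ) * tiltedNorm ρ w := by
  have hsum : 0 ≤ ∑ i, w i ^ (1 + ρ)⁻¹ := sum_nonneg fun i _ => Real.rpow_nonneg (hw i) _
  rw [tiltedNorm, tiltedNorm, ← Real.mul_rpow (Nat.cast_nonneg _) hsum, mul_sum]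
  simp only [Fintype.sum_prod_type, sum_const, card_univ, nsmul_eq_mul]

theorem tiltedNorm_le_rpow_mul_average [Nonempty κ] (hρ : 0 ≤ ρ) (hw : 0 ≤ w) {a : ι × κ → ℝ}
    (ha : ∀ p, 0 < a p) {c : ℝ} (hc : ∑ p, (a p)⁻¹ ≤ Fintype.card κ * c) :
    tiltedNorm ρ w ≤
      c ^ ρ * ((Fintype.card κ : ℝ)⁻¹ * ∑ p : ι × κ, w p.1 * a p ^ ρ) := by
  have hκ : (0 : ℝ) < Fintype.card κ := Nat.cast_pos.2 Fintype.card_pos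
  have hinv : 0 ≤ ∑ p, (a p)⁻¹ := sum_nonneg fun p _ => (inv_pos.2 (ha p)).le
  have hc₀ : 0 ≤ c := nonneg_of_mul_nonneg_right (hinv.trans hc) hκ
  have hmoment : 0 ≤ ∑ p : ι × κ, w p.1 * a p ^ ρ :=
    sum_nonneg fun p _ => mul_nonneg (hw p.1) (Real.rpow_nonneg (ha p).le _)
  have hbound : (Fintype.card κ : ℝ) ^ (1 + ρ) * tiltedNorm ρ w ≤
      (Fintype.card κ : ℝ) ^ ρ * (c ^ ρ * ∑ p : ι × κ, w p.1 * a p ^ ρ) :=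
    calc (Fintype.card κ : ℝ) ^ (1 + ρ) * tiltedNorm ρ w
        = tiltedNorm ρ (fun p : ι × κ => w p.1) := (tiltedNorm_comp_fst hw).symm
      _ ≤ (∑ p : ι × κ, w p.1 * a p ^ ρ) * (∑ p, (a p)⁻¹) ^ ρ :=
          tiltedNorm_le_sum_mul_rpow_mul_sum_inv_rpow hρ (fun p => hw p.1) ha
      _ ≤ (∑ p : ι × κ, w p.1 * a p ^ ρ) * (Fintype.card κ * c) ^ ρ := by gcongr
      _ = (Fintype.card κ : ℝ) ^ ρ * (c ^ ρ * ∑ p : ι × κ, w p.1 * a p ^ ρ) := by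
          rw [Real.mul_rpow hκ.le hc₀]
          ring
  rw [add_comm, Real.rpow_add_one hκ.ne', mul_assoc] at hbound
  rw [mul_left_comm, le_inv_mul_iff₀ hκ]
  exact le_of_mul_le_mul_left hbound (Real.rpow_pos_of_pos hκ ρ)

theorem escort_nonneg (hw : 0 ≤ w) : 0 ≤ escort ρ w := fun i =>
  div_nonneg (Real.rpow_nonneg (hw i) _) (sum_nonneg fun j _ => Real.rpow_nonneg (hw j) _)

theorem escort_pos (hw : 0 ≤ w) {i : ι} (hi : 0 < w i) : 0 < escort ρ w i :=
  div_pos (Real.rpow_pos_of_pos hi _) (sum_pos' (fun j _ => Real.rpow_nonneg (hw j) _)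
    ⟨i, mem_univ i, Real.rpow_pos_of_pos hi _⟩)

theorem sum_escort_le_one (w : ι → ℝ) : ∑ i, escort ρ w i ≤ 1 := by
  simp only [escort, ← sum_div]
  exact div_self_le_one _

theorem sum_mul_inv_escort_rpow (hρ : 0 ≤ ρ) (hw : 0 ≤ w) :
    ∑ i, w i * (escort ρ w i)⁻¹ ^ ρ = tiltedNorm ρ w := by
  have hρ' : 1 + ρ ≠ 0 := by positivity
  have hsum : 0 ≤ ∑ j, w j ^ (1 + ρ)⁻¹ := sum_nonneg fun j _ => Real.rpow_nonneg (hw j) _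
  rw [tiltedNorm, Real.rpow_one_add' hsum hρ', sum_mul]
  refine sum_congr rfl fun i _ => ?_
  rcases (hw i).eq_or_lt with hi | hi
  · rw [← hi, Pi.zero_apply, zero_mul, Real.zero_rpow (inv_ne_zero hρ'), zero_mul]
  · have hq := Real.rpow_pos_of_pos hi (1 + ρ)⁻¹
    rw [escort, inv_div, Real.div_rpow hsum hq.le]
    nth_rewrite 1 [← Real.rpow_inv_rpow (hw i) hρ']
    rw [Real.rpow_one_add' hq.le hρ']
    field_simp [(Real.rpow_pos_of_pos hq ρ).ne']

end TiltedNorm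

section Guessing

variable {X S : Type*} [Fintype X]

theorem exists_equiv_fin_antitone {α : Type*} [LinearOrder α] (w : X → α) :
    ∃ e : X ≃ Fin (Fintype.card X), Antitone (w ∘ e.symm) := by
  let e₀ := Fintype.equivFin X
  refine ⟨e₀.trans (Tuple.sort (OrderDual.toDual ∘ w ∘ e₀.symm)).symm, fun i j hij => ?_⟩
  exact Tuple.monotone_sort (OrderDual.toDual ∘ w ∘ e₀.symm) hij

theorem exists_guessFun_guessNo_mul_le_sum {w : S → X → ℝ} (hw : ∀ s, 0 ≤ w s) :
    ∃ G : GuessFun X S, ∀ s x, (guessNo G x s : ℝ) * w s x ≤ ∑ x', w s x' := by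
  choose G hG using fun s => exists_equiv_fin_antitone (w s)
  refine ⟨G, fun s x => ?_⟩
  calc (guessNo G x s : ℝ) * w s x = ∑ _i ∈ Iic (G s x), w s x := by
        rw [sum_const, Fin.card_Iic, nsmul_eq_mul, guessNo]
    _ ≤ ∑ i ∈ Iic (G s x), w s ((G s).symm i) := sum_le_sum fun i hi => by
        simpa using hG s (mem_Iic.1 hi)
    _ ≤ ∑ i, w s ((G s).symm i) :=
        sum_le_univ_sum_of_nonneg fun i => hw s _
    _ = ∑ x', w s x' := (G s).symm.sum_comp (w s)

theorem exists_guessFun_guessNo_le_inv_escort (ρ : ℝ) {w : S → X → ℝ} (hw : ∀ s, 0 ≤ w s) :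
    ∃ G : GuessFun X S, ∀ s x, 0 < w s x → (guessNo G x s : ℝ) ≤ (escort ρ (w s) x)⁻¹ := by
  obtain ⟨G, hG⟩ := exists_guessFun_guessNo_mul_le_sum fun s => escort_nonneg (ρ := ρ) (hw s)
  refine ⟨G, fun s x hx => ?_⟩
  rw [← one_div, le_div_iff₀ (escort_pos (hw s) hx)]
  exact (hG s x).trans (sum_escort_le_one _)

theorem sum_indicator_inv_ncard_le_one (L : Set X) :
    ∑ x, L.indicator (fun _ => (L.ncard : ℝ)⁻¹) x ≤ 1 := by
  classical
  simp only [Set.indicator_apply]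
  rw [← sum_filter, sum_const, nsmul_eq_mul, ← Set.ncard_coe_finset, coe_filter_univ]
  exact mul_inv_le_one

theorem exists_guessFun_guessNo_le_card_mul_ncard {B : Type*} [Fintype B] (L : S → B → Set X) :
    ∃ G : GuessFun X S, ∀ s b, ∀ x ∈ L s b,
      guessNo G x s ≤ Fintype.card B * (L s b).ncard := by
  let u : S → B → X → ℝ := fun s b => (L s b).indicator fun _ => ((L s b).ncard : ℝ)⁻¹
  have hu : ∀ s b x, 0 ≤ u s b x := fun s b =>
    Set.indicator_nonneg fun _ _ => inv_nonneg.2 (Nat.cast_nonneg _)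
  obtain ⟨G, hG⟩ := exists_guessFun_guessNo_mul_le_sum (w := fun s x => ∑ b, u s b x)
    fun s x => sum_nonneg fun b _ => hu s b x
  refine ⟨G, fun s b x hx => ?_⟩
  have hpos : (0 : ℝ) < (L s b).ncard := by
    exact_mod_cast (Set.ncard_pos (Set.toFinite _)).2 ⟨x, hx⟩
  have hbound : (guessNo G x s : ℝ) * ((L s b).ncard : ℝ)⁻¹ ≤ Fintype.card B :=
    calc (guessNo G x s : ℝ) * ((L s b).ncard : ℝ)⁻¹
        = guessNo G x s * u s b x := by simp only [u, Set.indicator_of_mem hx]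
      _ ≤ guessNo G x s * ∑ b, u s b x := by
          gcongr
          exact single_le_sum (f := fun b => u s b x) (fun b _ => hu s b x) (mem_univ b)
      _ ≤ ∑ x', ∑ b, u s b x' := hG s x
      _ = ∑ b, ∑ x', u s b x' := sum_comm
      _ ≤ ∑ _b : B, 1 := sum_le_sum fun b _ => sum_indicator_inv_ncard_le_one (L s b)
      _ = Fintype.card B := by simp
  rw [← div_eq_mul_inv, div_le_iff₀ hpos] at hbound
  exact_mod_cast hbound

theorem sum_inv_guessNo_le (G : GuessFun X S) (s : S) :
    ∑ x, (guessNo G x s : ℝ)⁻¹ ≤ 1 + Real.log (Fintype.card X) := by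
  calc ∑ x, (guessNo G x s : ℝ)⁻¹ = ∑ i : Fin (Fintype.card X), (((i : ℕ) + 1 : ℕ) : ℝ)⁻¹ :=
        (G s).sum_comp fun i => (((i : ℕ) + 1 : ℕ) : ℝ)⁻¹
    _ = (harmonic (Fintype.card X) : ℚ) := by
        rw [Fin.sum_univ_eq_sum_range fun i => ((i + 1 : ℕ) : ℝ)⁻¹, harmonic]
        push_cast
        rfl
    _ ≤ 1 + Real.log (Fintype.card X) := harmonic_le_one_add_log _

theorem sum_inv_guessNo_perm_le {K A : Type*} [Fintype K] [Fintype A] (G : GuessFun X (K × A))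
    (σ : X → Equiv.Perm K) (v : X → A) :
    ∑ p : X × K, (guessNo G p.1 (σ p.1 p.2, v p.1) : ℝ)⁻¹ ≤
      Fintype.card K * (Fintype.card A * (1 + Real.log (Fintype.card X))) := by
  have hnonneg : ∀ x s, 0 ≤ (guessNo G x s : ℝ)⁻¹ := fun x s => inv_nonneg.2 (Nat.cast_nonneg _)
  calc ∑ p : X × K, (guessNo G p.1 (σ p.1 p.2, v p.1) : ℝ)⁻¹
      = ∑ x, ∑ k, (guessNo G x (k, v x) : ℝ)⁻¹ := by
        rw [Fintype.sum_prod_type]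
        exact sum_congr rfl fun x _ => Equiv.sum_comp (σ x) fun k => (guessNo G x (k, v x) : ℝ)⁻¹
    _ ≤ ∑ x, ∑ k, ∑ a, (guessNo G x (k, a) : ℝ)⁻¹ :=
        sum_le_sum fun x _ => sum_le_sum fun k _ =>
          single_le_sum (f := fun a => (guessNo G x (k, a) : ℝ)⁻¹) (fun a _ => hnonneg x _)
            (mem_univ (v x))
    _ = ∑ s, ∑ x, (guessNo G x s : ℝ)⁻¹ := by
        rw [sum_comm (s := univ (α := K × A))]
        simp only [Fintype.sum_prod_type]
    _ ≤ ∑ _s : K × A, (1 + Real.log (Fintype.card X)) :=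
        sum_le_sum fun s _ => sum_inv_guessNo_le G s
    _ = Fintype.card K * (Fintype.card A * (1 + Real.log (Fintype.card X))) := by
        rw [sum_const, card_univ, Fintype.card_prod, nsmul_eq_mul, Nat.cast_mul, mul_assoc]

end Guessing

section Lists

variable {α κ X Z : Type*} [Fintype κ] [Fintype X] [Fintype Z]

theorem exists_map_ncard_fiber_le [Finite α] (c : α → κ) (b s : κ → ℕ)
    (hbs : ∀ k, {a | c a = k}.ncard ≤ b k * s k) (hZ : ∑ k, b k ≤ Fintype.card Z) :
    ∃ f : α → Z, ∀ a, {a' | f a' = f a}.ncard ≤ s (c a) := by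
  have := fun k => Fintype.ofFinite {a // c a = k}
  have hclass : ∀ k, Nonempty ({a // c a = k} ↪ Fin (b k) × Fin (s k)) := fun k => by
    refine Function.Embedding.nonempty_of_card_le ?_
    rw [Fintype.card_prod, Fintype.card_fin, Fintype.card_fin, ← Nat.card_eq_fintype_card]
    exact hbs k
  let e := fun k => (hclass k).some
  obtain ⟨i⟩ : Nonempty ((Σ k, Fin (b k)) ↪ Z) :=
    Function.Embedding.nonempty_of_card_le (by simpa using hZ)
  have hinj : ∀ k k' (x : {a // c a = k}) (x' : {a // c a = k'}),
      (⟨k, (e k x).1⟩ : Σ k, Fin (b k)) = ⟨k', (e k' x').1⟩ →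
        ((e k x).2 : ℕ) = (e k' x').2 → x.1 = x'.1 := by
    intro k k' x x' hblock hpos
    obtain ⟨rfl, hblock⟩ := Sigma.mk.inj_iff.1 hblock
    rw [(e k).injective (Prod.ext (eq_of_heq hblock) (Fin.ext hpos))]
  refine ⟨fun a => i ⟨c a, (e (c a) ⟨a, rfl⟩).1⟩, fun a => ?_⟩
  calc {a' | i ⟨c a', (e (c a') ⟨a', rfl⟩).1⟩ = i ⟨c a, (e (c a) ⟨a, rfl⟩).1⟩}.ncard
      ≤ (Set.Iio (s (c a))).ncard := by
        refine Set.ncard_le_ncard_of_injOn (fun a' => ((e (c a') ⟨a', rfl⟩).2 : ℕ))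
          (fun a' ha' => ?_) (fun a₁ h₁ a₂ h₂ h => ?_) (Set.finite_Iio _)
        · exact (Fin.is_lt _).trans_eq (congrArg (s ∘ Sigma.fst) (i.injective ha'))
        · exact hinj _ _ ⟨a₁, rfl⟩ ⟨a₂, rfl⟩ (i.injective (h₁.trans h₂.symm)) h
    _ = s (c a) := by rw [← coe_Iio, Set.ncard_coe_finset, Nat.card_Iio]

theorem natCeil_card_div_two_pow_le {α : Type*} {s : Finset α} {l : α → ℕ}
    (hl : ∀ a ∈ s, l a ≠ 0) {k : ℕ} (hs : ∀ a ∈ s, Nat.log 2 (l a) = k) :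
    (⌈(#s : ℝ) / 2 ^ k⌉₊ : ℝ) ≤ 1 + 2 * ∑ a ∈ s, (l a : ℝ)⁻¹ := by
  have hdyadic : ∀ a ∈ s, ((2 : ℝ) ^ k)⁻¹ ≤ 2 * (l a : ℝ)⁻¹ := by
    intro a ha
    have hlt : (l a : ℝ) < 2 ^ k * 2 := by
      rw [← pow_succ, ← hs a ha]
      exact_mod_cast Nat.lt_pow_succ_log_self one_lt_two (l a)
    have hpos : (0 : ℝ) < l a := by exact_mod_cast (hl a ha).bot_lt
    rw [← div_eq_mul_inv, le_div_iff₀ hpos, inv_mul_le_iff₀ (by positivity)]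
    exact hlt.le
  calc (⌈(#s : ℝ) / 2 ^ k⌉₊ : ℝ) ≤ #s / 2 ^ k + 1 := (Nat.ceil_lt_add_one (by positivity)).le
    _ = 1 + ∑ _a ∈ s, ((2 : ℝ) ^ k)⁻¹ := by
        rw [sum_const, nsmul_eq_mul, div_eq_mul_inv, add_comm]
    _ ≤ 1 + 2 * ∑ a ∈ s, (l a : ℝ)⁻¹ := by
        rw [mul_sum]
        gcongr with a ha
        exact hdyadic a ha

theorem exists_map_ncard_fiber_le_of_sum_inv_le [Fintype α] {l : α → ℕ} (hl : ∀ a, l a ≠ 0) {K : ℕ}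
    (hK : Fintype.card α ≤ 2 ^ K)
    (hZ : 2 * ∑ a, (l a : ℝ)⁻¹ + K + 1 ≤ Fintype.card Z) :
    ∃ f : α → Z, ∀ a, {a' | f a' = f a}.ncard ≤ l a := by
  -- Class `k < K` consists of the `a` with `2 ^ k ≤ l a < 2 ^ (k + 1)`. All larger `l a` go to
  -- class `K`, for which a single block suffices since `α` has at most `2 ^ K` elements.
  let c : α → Fin (K + 1) := fun a => ⟨min (Nat.log 2 (l a)) K, by lia⟩
  let C : Fin (K + 1) → Finset α := fun k => {a | c a = k}
  let b : Fin (K + 1) → ℕ := fun k => ⌈(#(C k) : ℝ) / 2 ^ (k : ℕ)⌉₊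
  have hinv_nonneg : ∀ a, (0 : ℝ) ≤ (l a : ℝ)⁻¹ := fun a => inv_nonneg.2 (Nat.cast_nonneg _)
  have hb : ∀ k, (b k : ℝ) ≤ 1 + 2 * ∑ a ∈ C k, (l a : ℝ)⁻¹ := by
    intro k
    rcases (Fin.is_le k).eq_or_lt with hk | hk
    · have hlast : b k ≤ 1 := by
        rw [Nat.ceil_le, Nat.cast_one, div_le_one (by positivity), hk]
        exact_mod_cast (card_le_univ _).trans hK
      have : (b k : ℝ) ≤ 1 := by exact_mod_cast hlast
      linarith [sum_nonneg fun a (_ : a ∈ C k) => hinv_nonneg a]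
    · refine natCeil_card_div_two_pow_le (fun a _ => hl a) fun a ha => ?_
      have : min (Nat.log 2 (l a)) K = k := congrArg Fin.val (mem_filter.1 ha).2
      lia
  have hcover : ∀ k, {a | c a = k}.ncard ≤ b k * 2 ^ (k : ℕ) := fun k => by
    have hceil := (div_le_iff₀ (by positivity)).1 (Nat.le_ceil ((#(C k) : ℝ) / 2 ^ (k : ℕ)))
    rw [← coe_filter_univ, Set.ncard_coe_finset, ← Nat.cast_le (α := ℝ)]
    push_cast
    exact hceil
  have hcount : ∑ k, b k ≤ Fintype.card Z := by
    have : (∑ k, (b k : ℝ)) ≤ Fintype.card Z :=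
      calc ∑ k, (b k : ℝ) ≤ ∑ k, (1 + 2 * ∑ a ∈ C k, (l a : ℝ)⁻¹) := sum_le_sum fun k _ => hb k
        _ = 2 * ∑ a, (l a : ℝ)⁻¹ + K + 1 := by
            rw [sum_add_distrib, ← mul_sum, sum_fiberwise]
            simp only [sum_const, card_univ, Fintype.card_fin, nsmul_eq_mul]
            push_cast
            ring
        _ ≤ Fintype.card Z := hZ
    exact_mod_cast this
  obtain ⟨f, hf⟩ := exists_map_ncard_fiber_le c b (fun k => 2 ^ (k : ℕ)) hcover hcount
  exact ⟨f, fun a => (hf a).trans <| (Nat.pow_le_pow_right two_pos (min_le_left _ _)).trans <|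
    Nat.pow_log_le_self 2 (hl a)⟩

theorem ncard_setOf_and_extend_eq {X Z : Type*} {p : X → Prop}
    (f : Subtype p → Z) (g : X → Z) (z : Z) :
    {x | p x ∧ Function.extend Subtype.val f g x = z}.ncard = {a | f a = z}.ncard := by
  rw [← Set.ncard_image_of_injective {a | f a = z} Subtype.val_injective]
  congr 1
  ext x
  constructor
  · rintro ⟨hx, h⟩
    exact ⟨⟨x, hx⟩, (Subtype.val_injective.extend_apply f g ⟨x, hx⟩).symm.trans h, rfl⟩
  · rintro ⟨a, ha, rfl⟩
    exact ⟨a.2, (Subtype.val_injective.extend_apply f g a).trans ha⟩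

theorem natCast_clog_two_lt (n : ℕ) : (Nat.clog 2 n : ℝ) < Real.logb 2 n + 1 := by
  have hlog : 0 ≤ Real.logb 2 n :=
    div_nonneg (Real.log_natCast_nonneg _) (Real.log_nonneg one_le_two)
  have hceil : ⌈Real.logb 2 n⌉₊ = Nat.clog 2 n := by exact_mod_cast Real.natCeil_logb_natCast 2 n
  exact hceil ▸ Nat.ceil_lt_add_one hlog

theorem natCeil_rpow_lt {ρ ξ : ℝ} (hρ : 0 < ρ) (hξ : 0 < ξ) :
    (⌈ξ⌉₊ : ℝ) ^ ρ < 1 + (2 * ξ) ^ ρ := by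
  have hpos : 0 < (2 * ξ) ^ ρ := by positivity
  rcases le_or_gt ξ 1 with hle | hlt
  · have hceil : (⌈ξ⌉₊ : ℝ) ≤ 1 := by exact_mod_cast Nat.ceil_le.2 (by exact_mod_cast hle)
    linarith [Real.rpow_le_one (Nat.cast_nonneg _) hceil hρ.le]
  · have hceil : (⌈ξ⌉₊ : ℝ) ≤ 2 * ξ := by linarith [Nat.ceil_lt_add_one (zero_le_one.trans hlt.le)]
    linarith [Real.rpow_le_rpow (Nat.cast_nonneg _) hceil hρ.le]

theorem sum_inv_natCeil_inv_escort_le {ρ : ℝ} {w : X → ℝ} (hw : 0 ≤ w) {c : ℝ} (hc : 0 < c) :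
    ∑ x : {x // 0 < w x}, (⌈c * (escort ρ w x)⁻¹⌉₊ : ℝ)⁻¹ ≤ c⁻¹ := by
  classical
  calc ∑ x : {x // 0 < w x}, (⌈c * (escort ρ w x)⁻¹⌉₊ : ℝ)⁻¹
      ≤ ∑ x : {x // 0 < w x}, c⁻¹ * escort ρ w x := by
        gcongr with x
        have hpos := mul_pos hc (inv_pos.2 (escort_pos (ρ := ρ) hw x.2))
        simpa only [mul_inv, inv_inv] using inv_anti₀ hpos (Nat.le_ceil _)
    _ ≤ c⁻¹ * ∑ x, escort ρ w x := by
        rw [← mul_sum]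
        gcongr
        rw [← sum_subtype ({x | 0 < w x} : Finset X) (by simp)]
        exact sum_le_univ_sum_of_nonneg (escort_nonneg hw)
    _ ≤ c⁻¹ := mul_le_of_le_one_right (inv_nonneg.2 hc.le) (sum_escort_le_one w)

theorem exists_map_ncard_rpow_lt {ρ : ℝ} (hρ : 0 < ρ) {w : X → ℝ} (hw : 0 ≤ w) {T : ℝ}
    (hT : 0 < T) (hZ : T + Real.logb 2 (Fintype.card X) + 2 ≤ Fintype.card Z) :
    ∃ f : X → Z, ∀ x, 0 < w x →
      ({x' | 0 < w x' ∧ f x' = f x}.ncard : ℝ) ^ ρ < 1 + (4 / T * (escort ρ w x)⁻¹) ^ ρ := by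
  -- One factor 2 of the constant 4 is lost to the dyadic classes, the other to rounding up.
  let ξ : X → ℝ := fun x => 2 / T * (escort ρ w x)⁻¹
  have hξ : ∀ x, 0 < w x → 0 < ξ x := fun x hx => by
    have := escort_pos (ρ := ρ) hw hx
    positivity
  have hsum : ∑ x : {x // 0 < w x}, (⌈ξ x⌉₊ : ℝ)⁻¹ ≤ (2 / T)⁻¹ :=
    sum_inv_natCeil_inv_escort_le hw (div_pos two_pos hT)
  rw [inv_div] at hsum
  have hclog := natCast_clog_two_lt (Fintype.card X)
  obtain ⟨f, hf⟩ := exists_map_ncard_fiber_le_of_sum_inv_le (Z := Z)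
    (l := fun x : {x // 0 < w x} => ⌈ξ x⌉₊) (fun x => (Nat.ceil_pos.2 (hξ x x.2)).ne')
    ((Fintype.card_subtype_le _).trans (Nat.le_pow_clog one_lt_two _)) (by linarith)
  have hZpos : (0 : ℝ) < Fintype.card Z := by
    linarith [Nat.cast_nonneg (α := ℝ) (Nat.clog 2 (Fintype.card X))]
  have hne : Nonempty Z := Fintype.card_pos_iff.1 (Nat.cast_pos.1 hZpos)
  refine ⟨Function.extend Subtype.val f fun _ => Classical.choice hne, fun x hx => ?_⟩
  rw [Subtype.val_injective.extend_apply f _ ⟨x, hx⟩, ncard_setOf_and_extend_eq]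
  calc ({x' | f x' = f ⟨x, hx⟩}.ncard : ℝ) ^ ρ ≤ (⌈ξ x⌉₊ : ℝ) ^ ρ := by
        gcongr
        exact hf ⟨x, hx⟩
    _ < 1 + (2 * ξ x) ^ ρ := natCeil_rpow_lt hρ (hξ x hx)
    _ = 1 + (4 / T * (escort ρ w x)⁻¹) ^ ρ := by
        congr 2
        ring

end Lists

section Source

variable {X Y : Type*}

/-- The subprobability weights `x ↦ P(x, y)` on `X` for a fixed side information `y`. -/
def slice (P : PMF (X × Y)) (y : Y) (x : X) : ℝ :=
  (P (x, y)).toReal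

theorem slice_nonneg (P : PMF (X × Y)) (y : Y) : 0 ≤ slice P y := fun _ =>
  ENNReal.toReal_nonneg

theorem pmf_toReal_pos {α : Type*} (p : PMF α) {a : α} : 0 < (p a).toReal ↔ a ∈ p.support := by
  rw [ENNReal.toReal_pos_iff, PMF.mem_support_iff, pos_iff_ne_zero,
    and_iff_left (p.apply_lt_top a)]

theorem sum_pmf_toReal {α : Type*} [Fintype α] (p : PMF α) : ∑ a, (p a).toReal = 1 := by
  rw [← ENNReal.toReal_sum fun a _ => p.apply_ne_top a, ← tsum_fintype (L := .unconditional _),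
    p.tsum_coe, ENNReal.toReal_one]

theorem sum_map_toReal_mul {U M : Type*} [Fintype U] [Fintype M] (p : PMF U) (g : U → M)
    (F : M → ℝ) : ∑ m, (p.map g m).toReal * F m = ∑ u, (p u).toReal * F (g u) := by
  classical
  have hmap : ∀ m, (p.map g m).toReal = ∑ u, if m = g u then (p u).toReal else 0 := fun m => by
    rw [PMF.map_apply, tsum_fintype, ENNReal.toReal_sum fun u _ => by
      split_ifs
      exacts [p.apply_ne_top u, ENNReal.zero_ne_top]]
    exact sum_congr rfl fun u _ => by split_ifs <;> rfl
  simp only [hmap, sum_mul, ite_mul, zero_mul]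
  rw [sum_comm]
  simp only [sum_ite_eq', mem_univ, if_true]

variable [Fintype X] [Fintype Y] {ρ : ℝ}

/-- The exponential `2 ^ (ρ H)` of the conditional Rényi entropy `H` of order `1 / (1 + ρ)`, as a
sum of quasi-norms over the side information. -/
noncomputable def renyiPower (ρ : ℝ) (P : PMF (X × Y)) : ℝ :=
  ∑ y, tiltedNorm ρ (slice P y)

theorem renyiPower_pos (ρ : ℝ) (P : PMF (X × Y)) : 0 < renyiPower ρ P := by
  obtain ⟨⟨x, y⟩, hxy⟩ := P.support_nonempty
  exact sum_pos' (fun y _ => tiltedNorm_nonneg (slice_nonneg P y))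
    ⟨y, mem_univ y, tiltedNorm_pos (slice_nonneg P y) ((pmf_toReal_pos P).2 hxy)⟩

theorem mul_condRenyiEntropy_eq_logb_renyiPower (hρ : 0 < ρ) (P : PMF (X × Y)) :
    ρ * condRenyiEntropy (1 / (1 + ρ)) P = Real.logb 2 (renyiPower ρ P) := by
  have hfactor : 1 / (1 + ρ) / (1 - 1 / (1 + ρ)) = 1 / ρ := by
    have : 1 + ρ ≠ 0 := by positivity
    rw [one_sub_div this, add_sub_cancel_left, div_div_div_cancel_right₀ this]
  rw [condRenyiEntropy, hfactor, one_div_one_div, one_div, one_div, mul_inv_cancel_left₀ hρ.ne']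
  rfl

theorem two_rpow_mul_condRenyiEntropy (hρ : 0 < ρ) (P : PMF (X × Y)) :
    (2 : ℝ) ^ (ρ * condRenyiEntropy (1 / (1 + ρ)) P) = renyiPower ρ P := by
  rw [mul_condRenyiEntropy_eq_logb_renyiPower hρ,
    Real.rpow_logb two_pos (by norm_num) (renyiPower_pos ρ P)]

theorem two_rpow_mul_condRenyiEntropy_sub_logb (hρ : 0 < ρ) (P : PMF (X × Y)) {c : ℝ}
    (hc : 0 < c) :
    (2 : ℝ) ^ (ρ * (condRenyiEntropy (1 / (1 + ρ)) P - Real.logb 2 c)) =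
      renyiPower ρ P / c ^ ρ := by
  rw [mul_sub, Real.rpow_sub two_pos, two_rpow_mul_condRenyiEntropy hρ, mul_comm ρ,
    Real.rpow_mul two_pos.le, Real.rpow_logb two_pos (by norm_num) hc]

theorem two_rpow_mul_condRenyiEntropy_sub_logb_add_two (hρ : 0 < ρ) (P : PMF (X × Y)) {c : ℝ}
    (hc : 0 < c) :
    (2 : ℝ) ^ (ρ * (condRenyiEntropy (1 / (1 + ρ)) P - Real.logb 2 c + 2)) =
      (4 / c) ^ ρ * renyiPower ρ P := by
  have hfour : Real.logb 2 4 = 2 := by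
    rw [show (4 : ℝ) = 2 ^ (2 : ℝ) by norm_num, Real.logb_rpow two_pos (by norm_num)]
  have hlog : Real.logb 2 (c / 4) = Real.logb 2 c - 2 := by
    rw [Real.logb_div hc.ne' four_ne_zero, hfour]
  rw [sub_add, ← hlog, two_rpow_mul_condRenyiEntropy_sub_logb hρ P (by positivity),
    div_eq_inv_mul, ← Real.inv_rpow (by positivity), inv_div]

end Source

section Expectation

variable {X Y M₁ M₂ : Type*}

theorem card_hints_pos [Fintype M₁] [Fintype M₂] (P : PMF (X × Y)) (W : Encoder X Y M₁ M₂) :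
    (0 : ℝ) < (Fintype.card M₁ : ℝ) * (Fintype.card M₂ : ℝ) := by
  obtain ⟨p, -⟩ := P.support_nonempty
  obtain ⟨m, -⟩ := (W p).support_nonempty
  have : Nonempty M₁ := ⟨m.1⟩
  have : Nonempty M₂ := ⟨m.2⟩
  positivity

theorem jointProb_nonneg (P : PMF (X × Y)) (W : Encoder X Y M₁ M₂) (x : X) (y : Y) (m₁ : M₁)
    (m₂ : M₂) : 0 ≤ jointProb P W x y m₁ m₂ :=
  mul_nonneg ENNReal.toReal_nonneg ENNReal.toReal_nonneg

theorem jointProb_pos_iff (P : PMF (X × Y)) (W : Encoder X Y M₁ M₂) {x : X} {y : Y} {m₁ : M₁}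
    {m₂ : M₂} : 0 < jointProb P W x y m₁ m₂ ↔
      0 < slice P y x ∧ (m₁, m₂) ∈ (W (x, y)).support := by
  rw [← pmf_toReal_pos]
  refine ⟨fun h => ⟨pos_of_mul_pos_left h ENNReal.toReal_nonneg,
    pos_of_mul_pos_right h ENNReal.toReal_nonneg⟩, fun h => mul_pos h.1 h.2⟩

theorem jointProb_mul_le_jointProb_mul {P : PMF (X × Y)} {W : Encoder X Y M₁ M₂} {x : X} {y : Y}
    {m₁ : M₁} {m₂ : M₂} {a b : ℝ} (h : 0 < jointProb P W x y m₁ m₂ → a ≤ b) :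
    jointProb P W x y m₁ m₂ * a ≤ jointProb P W x y m₁ m₂ * b := by
  rcases (jointProb_nonneg P W x y m₁ m₂).eq_or_lt with h₀ | hpos
  · rw [← h₀, zero_mul, zero_mul]
  · exact mul_le_mul_of_nonneg_left (h hpos) hpos.le

theorem sum_jointProb [Fintype M₁] [Fintype M₂] (P : PMF (X × Y)) (W : Encoder X Y M₁ M₂) (x : X)
    (y : Y) : ∑ m : M₁ × M₂, jointProb P W x y m.1 m.2 = slice P y x := by
  simp only [jointProb]
  rw [← mul_sum, sum_pmf_toReal, mul_one, slice]

theorem mem_bobList_iff [Fintype X] (P : PMF (X × Y)) (W : Encoder X Y M₁ M₂) {x : X} {y : Y}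
    {m₁ : M₁} {m₂ : M₂} : x ∈ bobList P W y m₁ m₂ ↔ 0 < jointProb P W x y m₁ m₂ := by
  refine ⟨fun h => (jointProb_nonneg P W x y m₁ m₂).lt_of_ne' fun h₀ => ?_, fun h => ?_⟩
  · have hpost : posterior P W x y m₁ m₂ = 0 := by rw [posterior, h₀, zero_div]
    exact h.ne' hpost
  · exact div_pos h (sum_pos' (fun x' _ => jointProb_nonneg P W x' y m₁ m₂) ⟨x, mem_univ x, h⟩)

theorem tiltedNorm_jointProb_le [Fintype X] {ρ : ℝ} (hρ : 0 ≤ ρ) (P : PMF (X × Y))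
    (W : Encoder X Y M₁ M₂) (y : Y) (m₁ : M₁) (m₂ : M₂) :
    tiltedNorm ρ (fun x => jointProb P W x y m₁ m₂) ≤
      ((bobList P W y m₁ m₂).ncard : ℝ) ^ ρ * ∑ x, jointProb P W x y m₁ m₂ := by
  have hlist : bobList P W y m₁ m₂ = {x | 0 < jointProb P W x y m₁ m₂} :=
    Set.ext fun _ => mem_bobList_iff P W
  rw [hlist]
  exact tiltedNorm_le_ncard_rpow_mul_sum hρ fun x => jointProb_nonneg P W x y m₁ m₂

variable [Fintype X] [Fintype Y] [Fintype M₁] [Fintype M₂] {ρ : ℝ} (P : PMF (X × Y))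
  (W : Encoder X Y M₁ M₂)

theorem expect_eq_sum_prod (f : X → Y → M₁ → M₂ → ℝ) :
    expect P W f = ∑ i : X × Y × M₁ × M₂,
      jointProb P W i.1 i.2.1 i.2.2.1 i.2.2.2 * f i.1 i.2.1 i.2.2.1 i.2.2.2 := by
  simp only [expect, Fintype.sum_prod_type]

theorem expect_eq_sum_slice_mul (f : X → Y → M₁ → M₂ → ℝ) :
    expect P W f = ∑ y, ∑ x, slice P y x *
      ∑ m : M₁ × M₂, (W (x, y) m).toReal * f x y m.1 m.2 := by
  rw [expect, sum_comm]
  simp only [slice, jointProb, Fintype.sum_prod_type, mul_sum, mul_assoc]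

theorem expect_eq_sum_mul_sum_jointProb (f : Y → M₁ → M₂ → ℝ) :
    expect P W (fun _ => f) = ∑ y, ∑ m : M₁ × M₂, f y m.1 m.2 *
      ∑ x, jointProb P W x y m.1 m.2 := by
  rw [expect, sum_comm]
  refine sum_congr rfl fun y _ => ?_
  simp only [mul_sum]
  rw [sum_comm (s := (univ : Finset (M₁ × M₂)))]
  simp only [Fintype.sum_prod_type, mul_comm]

theorem expect_eq_sum_slice (f : X → Y → ℝ) :
    expect P W (fun x y _ _ => f x y) = ∑ y, ∑ x, slice P y x * f x y := by
  simp only [expect_eq_sum_slice_mul, ← sum_mul, sum_pmf_toReal, one_mul]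

theorem expect_one : expect P W (fun _ _ _ _ => 1) = 1 := by
  simp only [expect_eq_sum_slice P W fun _ _ => 1, mul_one, slice]
  rw [sum_comm, ← Fintype.sum_prod_type fun p => (P p).toReal, sum_pmf_toReal]

theorem expect_add (f g : X → Y → M₁ → M₂ → ℝ) :
    expect P W (fun x y m₁ m₂ => f x y m₁ m₂ + g x y m₁ m₂) = expect P W f + expect P W g := by
  simp only [expect, mul_add, sum_add_distrib]

theorem expect_const_mul (c : ℝ) (f : X → Y → M₁ → M₂ → ℝ) :
    expect P W (fun x y m₁ m₂ => c * f x y m₁ m₂) = c * expect P W f := by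
  simp only [expect, mul_sum, mul_left_comm]

theorem expect_inv_escort_rpow (hρ : 0 ≤ ρ) :
    expect P W (fun x y _ _ => (escort ρ (slice P y) x)⁻¹ ^ ρ) = renyiPower ρ P := by
  simp only [expect_eq_sum_slice P W fun x y => (escort ρ (slice P y) x)⁻¹ ^ ρ,
    sum_mul_inv_escort_rpow hρ (slice_nonneg P _), renyiPower]

variable {P W}

theorem expect_mono {f g : X → Y → M₁ → M₂ → ℝ}
    (h : ∀ x y m₁ m₂, 0 < jointProb P W x y m₁ m₂ → f x y m₁ m₂ ≤ g x y m₁ m₂) :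
    expect P W f ≤ expect P W g :=
  sum_le_sum fun x _ => sum_le_sum fun y _ => sum_le_sum fun m₁ _ => sum_le_sum fun m₂ _ =>
    jointProb_mul_le_jointProb_mul (h x y m₁ m₂)

theorem expect_lt_expect {f g : X → Y → M₁ → M₂ → ℝ}
    (h : ∀ x y m₁ m₂, 0 < jointProb P W x y m₁ m₂ → f x y m₁ m₂ < g x y m₁ m₂) :
    expect P W f < expect P W g := by
  obtain ⟨⟨x, y⟩, hxy⟩ := P.support_nonempty
  obtain ⟨⟨m₁, m₂⟩, hm⟩ := (W (x, y)).support_nonempty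
  have hpos : 0 < jointProb P W x y m₁ m₂ :=
    (jointProb_pos_iff P W).2 ⟨(pmf_toReal_pos P).2 hxy, hm⟩
  simp only [expect_eq_sum_prod]
  exact sum_lt_sum (fun i _ => jointProb_mul_le_jointProb_mul fun hi => (h _ _ _ _ hi).le)
    ⟨(x, y, m₁, m₂), mem_univ _, mul_lt_mul_of_pos_left (h x y m₁ m₂ hpos) hpos⟩

end Expectation

section Converse

variable {X Y M₁ M₂ : Type*} [Fintype X] [Fintype Y] [Fintype M₁] [Fintype M₂] {ρ : ℝ}

theorem one_le_bobListAmbiguity (hρ : 0 ≤ ρ) (P : PMF (X × Y)) (W : Encoder X Y M₁ M₂) :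
    1 ≤ bobListAmbiguity ρ P W := by
  rw [← expect_one P W]
  refine expect_mono fun x y m₁ m₂ hx => Real.one_le_rpow ?_ hρ
  exact_mod_cast (Set.ncard_pos (Set.toFinite _)).2 ⟨x, (mem_bobList_iff P W).2 hx⟩

theorem renyiPower_le_mul_bobListAmbiguity (hρ : 0 ≤ ρ) (P : PMF (X × Y))
    (W : Encoder X Y M₁ M₂) :
    renyiPower ρ P ≤
      ((Fintype.card M₁ : ℝ) * (Fintype.card M₂ : ℝ)) ^ ρ * bobListAmbiguity ρ P W := by
  rw [bobListAmbiguity, expect_eq_sum_mul_sum_jointProb, mul_sum, ← Nat.cast_mul,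
    ← Fintype.card_prod]
  refine sum_le_sum fun y _ => ?_
  calc tiltedNorm ρ (slice P y)
      = tiltedNorm ρ fun x => ∑ m : M₁ × M₂, jointProb P W x y m.1 m.2 := by
        simp only [sum_jointProb]
    _ ≤ (Fintype.card (M₁ × M₂) : ℝ) ^ ρ *
          ∑ m : M₁ × M₂, tiltedNorm ρ fun x => jointProb P W x y m.1 m.2 :=
        tiltedNorm_sum_le hρ fun m x => jointProb_nonneg P W x y m.1 m.2
    _ ≤ _ := by
        gcongr with m
        exact tiltedNorm_jointProb_le hρ P W y m.1 m.2

theorem natCast_rpow_le_mul_rpow (hρ : 0 ≤ ρ) {a b c : ℕ} (h : a ≤ b * c) :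
    (a : ℝ) ^ ρ ≤ (b : ℝ) ^ ρ * (c : ℝ) ^ ρ := by
  rw [← Real.mul_rpow (Nat.cast_nonneg _) (Nat.cast_nonneg _)]
  gcongr
  exact_mod_cast h

instance (S : Type*) : Nonempty (GuessFun X S) :=
  ⟨fun _ => Fintype.equivFin X⟩

theorem eveAmbiguity_le_eveAltAmbiguity (ρ : ℝ) (P : PMF (X × Y)) (W : Encoder X Y M₁ M₂) :
    eveAmbiguity ρ P W ≤ eveAltAmbiguity ρ P W := by
  have hle : ∀ G₁ G₂, eveAmbiguity ρ P W ≤ expect P W fun x y m₁ m₂ =>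
      min ((guessNo G₁ x (y, m₁) : ℝ) ^ ρ) ((guessNo G₂ x (y, m₂) : ℝ) ^ ρ) := fun G₁ G₂ =>
    ciInf_le (Set.finite_range _).bddBelow (G₁, G₂)
  refine le_min (le_ciInf fun G₁ => ?_) (le_ciInf fun G₂ => ?_)
  · exact (hle G₁ (Classical.arbitrary _)).trans (expect_mono fun _ _ _ _ _ => min_le_left _ _)
  · exact (hle (Classical.arbitrary _) G₂).trans (expect_mono fun _ _ _ _ _ => min_le_right _ _)

theorem eveAltAmbiguity_le_expect_left (ρ : ℝ) (P : PMF (X × Y)) (W : Encoder X Y M₁ M₂)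
    (G : GuessFun X (Y × M₁)) :
    eveAltAmbiguity ρ P W ≤ expect P W fun x y m₁ _ => (guessNo G x (y, m₁) : ℝ) ^ ρ :=
  (min_le_left _ _).trans (ciInf_le (Set.finite_range _).bddBelow G)

theorem eveAltAmbiguity_le_expect_right (ρ : ℝ) (P : PMF (X × Y)) (W : Encoder X Y M₁ M₂)
    (G : GuessFun X (Y × M₂)) :
    eveAltAmbiguity ρ P W ≤ expect P W fun x y _ m₂ => (guessNo G x (y, m₂) : ℝ) ^ ρ :=
  (min_le_right _ _).trans (ciInf_le (Set.finite_range _).bddBelow G)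

theorem eveAltAmbiguity_le_renyiPower (hρ : 0 ≤ ρ) (P : PMF (X × Y)) (W : Encoder X Y M₁ M₂) :
    eveAltAmbiguity ρ P W ≤ renyiPower ρ P := by
  obtain ⟨G, hG⟩ := exists_guessFun_guessNo_le_inv_escort ρ
    (w := fun s : Y × M₁ => slice P s.1) fun s => slice_nonneg P s.1
  calc eveAltAmbiguity ρ P W
      ≤ expect P W fun x y m₁ _ => (guessNo G x (y, m₁) : ℝ) ^ ρ :=
        eveAltAmbiguity_le_expect_left ρ P W G
    _ ≤ expect P W fun x y _ _ => (escort ρ (slice P y) x)⁻¹ ^ ρ :=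
        expect_mono fun x y m₁ _ hx => Real.rpow_le_rpow (Nat.cast_nonneg _)
          (hG (y, m₁) x ((jointProb_pos_iff P W).1 hx).1) hρ
    _ = renyiPower ρ P := expect_inv_escort_rpow P W hρ

theorem eveAltAmbiguity_le_card_left_rpow_mul (hρ : 0 ≤ ρ) (P : PMF (X × Y))
    (W : Encoder X Y M₁ M₂) :
    eveAltAmbiguity ρ P W ≤ (Fintype.card M₁ : ℝ) ^ ρ * bobListAmbiguity ρ P W := by
  obtain ⟨G, hG⟩ := exists_guessFun_guessNo_le_card_mul_ncard
    fun (s : Y × M₂) (m₁ : M₁) => bobList P W s.1 m₁ s.2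
  rw [bobListAmbiguity, ← expect_const_mul]
  exact (eveAltAmbiguity_le_expect_right ρ P W G).trans <| expect_mono fun x y m₁ m₂ hx =>
    natCast_rpow_le_mul_rpow hρ (hG (y, m₂) m₁ x ((mem_bobList_iff P W).2 hx))

theorem eveAltAmbiguity_le_card_right_rpow_mul (hρ : 0 ≤ ρ) (P : PMF (X × Y))
    (W : Encoder X Y M₁ M₂) :
    eveAltAmbiguity ρ P W ≤ (Fintype.card M₂ : ℝ) ^ ρ * bobListAmbiguity ρ P W := by
  obtain ⟨G, hG⟩ := exists_guessFun_guessNo_le_card_mul_ncard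
    fun (s : Y × M₁) (m₂ : M₂) => bobList P W s.1 s.2 m₂
  rw [bobListAmbiguity, ← expect_const_mul]
  exact (eveAltAmbiguity_le_expect_left ρ P W G).trans <| expect_mono fun x y m₁ m₂ hx =>
    natCast_rpow_le_mul_rpow hρ (hG (y, m₁) m₂ x ((mem_bobList_iff P W).2 hx))

theorem eveAltAmbiguity_le_min_card_rpow_mul (hρ : 0 ≤ ρ) (P : PMF (X × Y))
    (W : Encoder X Y M₁ M₂) :
    eveAltAmbiguity ρ P W ≤
      (min (Fintype.card M₁ : ℝ) (Fintype.card M₂ : ℝ)) ^ ρ * bobListAmbiguity ρ P W := by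
  rcases min_choice (Fintype.card M₁ : ℝ) (Fintype.card M₂ : ℝ) with h | h
  · rw [h]
    exact eveAltAmbiguity_le_card_left_rpow_mul hρ P W
  · rw [h]
    exact eveAltAmbiguity_le_card_right_rpow_mul hρ P W

end Converse

section OneTimePad

variable {X Y K A B M₁ M₂ : Type*} [AddGroup K] [Fintype K]

/-- The encoder that describes `x`, given the side information `y`, by `f y x = (k, a, b)`, draws
a uniform one-time pad `u` in the group `K` and puts `(k + u, a)` into the first hint and `(u, b)`
into the second one. The maps `i₁` and `i₂` embed these pairs into the sets of hints. -/
noncomputable def padEncoder (i₁ : K × A → M₁) (i₂ : K × B → M₂) (f : Y → X → K × A × B) :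
    Encoder X Y M₁ M₂ := fun p =>
  (PMF.uniformOfFintype K).map fun u =>
    (i₁ ((f p.2 p.1).1 + u, (f p.2 p.1).2.1), i₂ (u, (f p.2 p.1).2.2))

section Bob

variable [Fintype X] {i₁ : K × A → M₁} {i₂ : K × B → M₂}

theorem bobList_padEncoder_subset (P : PMF (X × Y)) (hi₁ : i₁.Injective) (hi₂ : i₂.Injective)
    {f : Y → X → K × A × B} {x : X} {y : Y} {m₁ : M₁} {m₂ : M₂}
    (hx : 0 < jointProb P (padEncoder i₁ i₂ f) x y m₁ m₂) :
    bobList P (padEncoder i₁ i₂ f) y m₁ m₂ ⊆ {x' | 0 < slice P y x' ∧ f y x' = f y x} := by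
  intro x' hx'
  obtain ⟨hpos, hm'⟩ := (jointProb_pos_iff _ _).1 ((mem_bobList_iff _ _).1 hx')
  obtain ⟨u', -, hu'⟩ := (PMF.mem_support_map_iff _ _ _).1 hm'
  obtain ⟨u, -, hu⟩ := (PMF.mem_support_map_iff _ _ _).1 ((jointProb_pos_iff _ _).1 hx).2
  obtain ⟨h₁, h₂⟩ := Prod.ext_iff.1 (hu'.trans hu.symm)
  obtain ⟨hsum, ha⟩ := Prod.ext_iff.1 (hi₁ h₁)
  obtain ⟨hpad, hb⟩ := Prod.ext_iff.1 (hi₂ h₂)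
  have hk : (f y x').1 + u' = (f y x).1 + u := hsum
  rw [show u' = u from hpad] at hk
  exact ⟨hpos, Prod.ext (add_right_cancel hk) (Prod.ext ha hb)⟩

theorem exists_bobListAmbiguity_padEncoder_lt [Fintype Y] [Fintype A] [Fintype B] [Fintype M₁]
    [Fintype M₂] {ρ : ℝ} (hρ : 0 < ρ) (P : PMF (X × Y)) (hi₁ : i₁.Injective)
    (hi₂ : i₂.Injective) {T : ℝ} (hT : 0 < T)
    (hZ : T + Real.logb 2 (Fintype.card X) + 2 ≤ Fintype.card (K × A × B)) :
    ∃ f : Y → X → K × A × B,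
      bobListAmbiguity ρ P (padEncoder i₁ i₂ f) < 1 + (4 / T) ^ ρ * renyiPower ρ P := by
  choose f hf using fun y => exists_map_ncard_rpow_lt hρ (slice_nonneg P y) hT hZ
  refine ⟨f, ?_⟩
  calc bobListAmbiguity ρ P (padEncoder i₁ i₂ f)
      < expect P (padEncoder i₁ i₂ f) fun x y _ _ =>
          1 + (4 / T * (escort ρ (slice P y) x)⁻¹) ^ ρ :=
        expect_lt_expect fun x y m₁ m₂ hx => lt_of_le_of_lt
          (Real.rpow_le_rpow (Nat.cast_nonneg _) (Nat.cast_le.2 <| Set.ncard_le_ncard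
            (bobList_padEncoder_subset P hi₁ hi₂ hx) (Set.toFinite _)) hρ.le)
          (hf y x ((jointProb_pos_iff _ _).1 hx).1)
    _ = expect P (padEncoder i₁ i₂ f) fun x y _ _ =>
          1 + (4 / T) ^ ρ * (escort ρ (slice P y) x)⁻¹ ^ ρ := by
        simp only [fun x y => Real.mul_rpow (z := ρ) (div_pos four_pos hT).le
          (inv_nonneg.2 (escort_nonneg (ρ := ρ) (slice_nonneg P y) x))]
    _ = 1 + (4 / T) ^ ρ * renyiPower ρ P := by
        rw [expect_add, expect_one, expect_const_mul, expect_inv_escort_rpow P _ hρ.le]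

end Bob

section Eve

variable [Fintype X]

theorem inv_min_le_add {a b : ℝ} (ha : 0 ≤ a) (hb : 0 ≤ b) : (min a b)⁻¹ ≤ a⁻¹ + b⁻¹ := by
  rcases min_choice a b with h | h <;> rw [h]
  · exact le_add_of_nonneg_right (inv_nonneg.2 hb)
  · exact le_add_of_nonneg_left (inv_nonneg.2 ha)

theorem sum_inv_min_guessNo_padEncoder_le [Fintype A] [Fintype B] (G₁ : GuessFun X (K × A))
    (G₂ : GuessFun X (K × B)) (f : X → K × A × B) :
    ∑ p : X × K, (min (guessNo G₁ p.1 ((f p.1).1 + p.2, (f p.1).2.1) : ℝ)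
        (guessNo G₂ p.1 (p.2, (f p.1).2.2)))⁻¹ ≤
      Fintype.card K *
        ((Fintype.card A + Fintype.card B) * (1 + Real.log (Fintype.card X))) :=
  calc _ ≤ ∑ p : X × K, ((guessNo G₁ p.1 ((f p.1).1 + p.2, (f p.1).2.1) : ℝ)⁻¹ +
          (guessNo G₂ p.1 (p.2, (f p.1).2.2) : ℝ)⁻¹) :=
        sum_le_sum fun _ _ => inv_min_le_add (Nat.cast_nonneg _) (Nat.cast_nonneg _)
    _ ≤ Fintype.card K * (Fintype.card A * (1 + Real.log (Fintype.card X))) +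
          Fintype.card K * (Fintype.card B * (1 + Real.log (Fintype.card X))) := by
        rw [sum_add_distrib]
        exact add_le_add
          (sum_inv_guessNo_perm_le G₁ (fun x => Equiv.addLeft (f x).1) fun x => (f x).2.1)
          (sum_inv_guessNo_perm_le G₂ (fun _ => Equiv.refl K) fun x => (f x).2.2)
    _ = _ := by ring

variable [Fintype Y] [Fintype M₁] [Fintype M₂]

theorem expect_padEncoder (P : PMF (X × Y)) (i₁ : K × A → M₁) (i₂ : K × B → M₂)
    (f : Y → X → K × A × B) (F : X → Y → M₁ → M₂ → ℝ) :
    expect P (padEncoder i₁ i₂ f) F =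
      ∑ y, (Fintype.card K : ℝ)⁻¹ * ∑ p : X × K, slice P y p.1 *
        F p.1 y (i₁ ((f y p.1).1 + p.2, (f y p.1).2.1)) (i₂ (p.2, (f y p.1).2.2)) := by
  rw [expect_eq_sum_slice_mul]
  refine sum_congr rfl fun y _ => ?_
  rw [Fintype.sum_prod_type, mul_sum]
  refine sum_congr rfl fun x _ => ?_
  simp only [padEncoder, sum_map_toReal_mul _ _ fun m : M₁ × M₂ => F x y m.1 m.2,
    PMF.uniformOfFintype_apply, ENNReal.toReal_inv, ENNReal.toReal_natCast, ← mul_sum]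
  exact mul_left_comm _ _ _

theorem renyiPower_le_rpow_mul_eveAmbiguity_padEncoder [Fintype A] [Fintype B] {ρ : ℝ}
    (hρ : 0 ≤ ρ) (P : PMF (X × Y)) (i₁ : K × A → M₁) (i₂ : K × B → M₂)
    (f : Y → X → K × A × B) :
    renyiPower ρ P ≤ ((Fintype.card A + Fintype.card B) * (1 + Real.log (Fintype.card X))) ^ ρ *
      eveAmbiguity ρ P (padEncoder i₁ i₂ f) := by
  rw [eveAmbiguity, Real.mul_iInf_of_nonneg (by
    have := Real.log_natCast_nonneg (Fintype.card X)
    positivity)]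
  refine le_ciInf fun G => ?_
  rw [expect_padEncoder, mul_sum]
  refine sum_le_sum fun y _ => ?_
  simp only [← (Real.monotoneOn_rpow_Ici_of_exponent_nonneg hρ).map_min
    (Set.mem_Ici.2 (Nat.cast_nonneg _)) (Set.mem_Ici.2 (Nat.cast_nonneg _))]
  exact tiltedNorm_le_rpow_mul_average hρ (slice_nonneg P y)
    (fun p => lt_min (Nat.cast_pos.2 (Nat.succ_pos _)) (Nat.cast_pos.2 (Nat.succ_pos _)))
    (sum_inv_min_guessNo_padEncoder_le (fun s => G.1 (y, i₁ s)) (fun s => G.2 (y, i₂ s)) (f y))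

theorem le_eveAmbiguity_padEncoder [Fintype A] [Nonempty A] [Fintype B] {ρ : ℝ} (hρ : 0 ≤ ρ)
    (P : PMF (X × Y)) (i₁ : K × A → M₁) (i₂ : K × B → M₂) (f : Y → X → K × A × B) :
    (1 + Real.log (Fintype.card X)) ^ (-ρ) *
        (renyiPower ρ P / ((Fintype.card A : ℝ) + Fintype.card B) ^ ρ) ≤
      eveAmbiguity ρ P (padEncoder i₁ i₂ f) := by
  have hlog : 0 < 1 + Real.log (Fintype.card X) := by
    linarith [Real.log_natCast_nonneg (Fintype.card X)]
  have hAB : (0 : ℝ) < (Fintype.card A : ℝ) + Fintype.card B := by positivity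
  rw [Real.rpow_neg hlog.le, inv_mul_le_iff₀ (Real.rpow_pos_of_pos hlog ρ),
    div_le_iff₀' (Real.rpow_pos_of_pos hAB ρ), ← mul_assoc, ← Real.mul_rpow hAB.le hlog.le]
  exact renyiPower_le_rpow_mul_eveAmbiguity_padEncoder hρ P i₁ i₂ f

end Eve

end OneTimePad

theorem exists_injective_prod_of_le_floor {M : Type*} [Fintype M] {s c : ℕ} (hs : 0 < s)
    (h : c ≤ ⌊(Fintype.card M : ℝ) / s⌋₊) : ∃ i : Fin s × Fin c → M, i.Injective := by
  rw [Nat.floor_div_natCast, Nat.floor_natCast, Nat.le_div_iff_mul_le hs, mul_comm] at h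
  obtain ⟨i⟩ := Function.Embedding.nonempty_of_card_le (α := Fin s × Fin c) (β := M)
    (by simpa only [Fintype.card_prod, Fintype.card_fin] using h)
  exact ⟨i, i.injective⟩

end DistStor

theorem mainTheorem4 {X Y M₁ M₂ : Type*} [Fintype X] [Fintype Y] [Fintype M₁] [Fintype M₂]
    (P : PMF (X × Y)) (ρ : ℝ) (hρ : 0 < ρ) :
    -- achievability
    (Real.logb 2 (Fintype.card X) + 2 < (Fintype.card M₁ : ℝ) * (Fintype.card M₂ : ℝ) →
      ∀ cs c₁ c₂ : ℕ, 1 ≤ cs → 1 ≤ c₁ → 1 ≤ c₂ →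
        cs ≤ min (Fintype.card M₁) (Fintype.card M₂) →
        c₁ ≤ ⌊(Fintype.card M₁ : ℝ) / (cs : ℝ)⌋₊ →
        c₂ ≤ ⌊(Fintype.card M₂ : ℝ) / (cs : ℝ)⌋₊ →
        Real.logb 2 (Fintype.card X) + 2 < (cs : ℝ) * (c₁ : ℝ) * (c₂ : ℝ) →
        ∃ W : DistStor.Encoder X Y M₁ M₂,
          DistStor.bobListAmbiguity ρ P W <
            1 + (2 : ℝ) ^ (ρ * (DistStor.condRenyiEntropy (1 / (1 + ρ)) P
              - Real.logb 2 ((cs : ℝ) * (c₁ : ℝ) * (c₂ : ℝ)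
                  - Real.logb 2 (Fintype.card X) - 2) + 2)) ∧
          (1 + Real.log (Fintype.card X)) ^ (-ρ) *
              (2 : ℝ) ^ (ρ * (DistStor.condRenyiEntropy (1 / (1 + ρ)) P
                - Real.logb 2 ((c₁ : ℝ) + (c₂ : ℝ)))) ≤
            DistStor.eveAmbiguity ρ P W) ∧
    -- converse
    (∀ W : DistStor.Encoder X Y M₁ M₂,
      max ((2 : ℝ) ^ (ρ * (DistStor.condRenyiEntropy (1 / (1 + ρ)) P
            - Real.logb 2 ((Fintype.card M₁ : ℝ) * (Fintype.card M₂ : ℝ))))) 1 ≤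
          DistStor.bobListAmbiguity ρ P W ∧
      DistStor.eveAmbiguity ρ P W ≤
        min ((min (Fintype.card M₁ : ℝ) (Fintype.card M₂ : ℝ)) ^ ρ *
              DistStor.bobListAmbiguity ρ P W)
          ((2 : ℝ) ^ (ρ * DistStor.condRenyiEntropy (1 / (1 + ρ)) P)) ∧
      DistStor.eveAltAmbiguity ρ P W ≤
        min ((min (Fintype.card M₁ : ℝ) (Fintype.card M₂ : ℝ)) ^ ρ *
              DistStor.bobListAmbiguity ρ P W)
          ((2 : ℝ) ^ (ρ * DistStor.condRenyiEntropy (1 / (1 + ρ)) P))) := by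
  refine ⟨fun _ cs c₁ c₂ hcs hc₁ _ _ hf₁ hf₂ hT => ?_, fun W => ?_⟩
  · have : NeZero cs := ⟨by lia⟩
    obtain ⟨i₁, hi₁⟩ := DistStor.exists_injective_prod_of_le_floor hcs hf₁
    obtain ⟨i₂, hi₂⟩ := DistStor.exists_injective_prod_of_le_floor hcs hf₂
    have hT₀ : 0 < (cs : ℝ) * c₁ * c₂ - Real.logb 2 (Fintype.card X) - 2 := by linarith
    obtain ⟨f, hf⟩ := DistStor.exists_bobListAmbiguity_padEncoder_lt (A := Fin c₁) (B := Fin c₂)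
      hρ P hi₁ hi₂ hT₀ (by
        simp only [Fintype.card_prod, Fintype.card_fin, Nat.cast_mul]
        linarith)
    have : NeZero c₁ := ⟨by lia⟩
    refine ⟨DistStor.padEncoder i₁ i₂ f, ?_, ?_⟩
    · rwa [DistStor.two_rpow_mul_condRenyiEntropy_sub_logb_add_two hρ P hT₀]
    · rw [DistStor.two_rpow_mul_condRenyiEntropy_sub_logb hρ P (by positivity)]
      simpa only [Fintype.card_fin] using DistStor.le_eveAmbiguity_padEncoder hρ.le P i₁ i₂ f
  · have hM := DistStor.card_hints_pos P W
    have hAlt := le_min (DistStor.eveAltAmbiguity_le_min_card_rpow_mul hρ.le P W)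
      (DistStor.eveAltAmbiguity_le_renyiPower hρ.le P W)
    rw [DistStor.two_rpow_mul_condRenyiEntropy hρ,
      DistStor.two_rpow_mul_condRenyiEntropy_sub_logb hρ P hM]
    exact ⟨max_le ((div_le_iff₀' (Real.rpow_pos_of_pos hM ρ)).2
        (DistStor.renyiPower_le_mul_bobListAmbiguity hρ.le P W))
      (DistStor.one_le_bobListAmbiguity hρ.le P W),
      (DistStor.eveAmbiguity_le_eveAltAmbiguity ρ P W).trans hAlt, hAlt⟩
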